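/- **Conventions.** Small categories form the $2$-category $\mathrm{Cat}$; $e$ is the punctual category. A *prederivator* is a strict $2$-functor $\mathbb D$ from $\mathrm{Cat}$ to (not necessarily small) categories, contravariant on functors and on natural transformations; write $u^*=\mathbb D(u):\mathbb D(B)\to\mathbb D(A)$ for $u:A\to B$. For $u:A\to B$ and an object $b$ of $B$, $A/b$ is the category of pairs $(a,\,u(a)\to b)$ and $b\backslash A$ that of pairs $(a,\,b\to u(a))$. A *square* consists of functors $u:A\to B$, $u':A'\to B'$, $v:A'\to A$, $w:B'\to B$ between small categories and a natural transformation $\alpha:uv\to wu'$. * A square has the *cohomological base-change property* for $\mathbb D$ if $u^*$ and $u'^*$ have right adjoints $u_*$ and $u'_*$ and the morphism $w^*u_*\to u'_*v^*$ deduced from $\alpha^*: u'^*w^*\to v^*u^*$ by adjunction is an isomorphism. It has the *homological base-change property* if $v^*$ and $w^*$ have left adjoints $v_!$ and $w_!$ and the morphism $v_!u'^*\to u^*w_!$ deduced from $\alpha^*$ is an isomorphism. * $\mathbb D$ is *conservative* if, for every small category $A$, a morphism $\varphi$ of $\mathbb D(A)$ is an isomorphism as soon as $a^*(\varphi)$ is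 one for every object $a:e\to A$ of $A$. * $\mathbb D$ is *complete* if every $u^*$ has a right adjoint and, for all $u:A\to B$ and $b\in\mathrm{Ob}\,B$, the comma square with sides $A/b\to A$, $A/b\to e$, $u:A\to B$, $b:e\to B$ has the cohomological base-change property. It is *cocomplete* if every $u^*$ has a left adjoint and, for all such $u$ and $b$, the comma square with sides $b\backslash A\to e$, $b\backslash A\to A$, $b:e\to B$, $u:A\to B$ has the homological base-change property. * $\mathbb D$ is a *derivator* if it is conservative, complete and cocomplete, and if for every finite family $(A_i)$ of small categories the canonical functor $\mathbb D(\coprod_i A_i)\to\prod_i\mathbb D(A_i)$ is an equivalence. * A functor $u:A\to B$ between small categories is a *$\mathbb D$-equivalence* if, with $q:B\to e$, the map $\mathrm{Hom}_{\mathbb D(B)}(q^*X,q^*Y)\to\mathrm{Hom}_{\mathbb D(A)}(u^*q^*X,u^*q^*Y)$ induced by $u^*$ is bijective for all objects $X,Y$ of $\mathbb D(e)$. It is *$\mathbb D$-coaspherical* if for every object $b$ of $B$ the induced functor $b\backslash A\to b\backslash B$ is a $\mathbb D$-equivalence. * A square is *$\mathbb D$-exact* if for every object $b'$ of $B'$ the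 functor $A'/b'\to A/w(b')$, $(a',\,g')\mapsto(v(a'),\,w(g')\circ\alpha_{a'})$, is $\mathbb D$-coaspherical. * If every $u^*$ has a right adjoint, $\mathbb D$ *satisfies the cohomological criterion for coaspherical morphisms* if for every $\mathbb D$-coaspherical $u:A\to B$ the commutative square with sides $u:A\to B$, $A\to e$, $B\to e$, $\mathrm{id}_e$ has the cohomological base-change property. **Theorem.** Let $\mathbb D$ be a prederivator. 1. If $\mathbb D$ is conservative and complete and satisfies the cohomological criterion for coaspherical morphisms, then every $\mathbb D$-exact square has the cohomological base-change property for $\mathbb D$. 2. If $\mathbb D$ is a derivator, then $\mathbb D$ satisfies the hypotheses of 1. -/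

import Mathlib

open CategoryTheory

universe s v₁ u₁

noncomputable section

/-- A square of functors has the left Beck-Chevalley property if its two vertical functors have
right adjoints and the base change morphism `R₁ ⋙ T ⟶ B ⋙ R₂` (the mate of the given 2-cell)
is an isomorphism. -/
def CategoryTheory.TwoSquare.IsLeftBeckChevalley {C₁ C₂ C₃ C₄ : Type*} [Category* C₁]
    [Category* C₂] [Category* C₃] [Category* C₄] {T : C₁ ⥤ C₂} {L : C₁ ⥤ C₃} {R : C₂ ⥤ C₄}
    {B : C₃ ⥤ C₄} (σ : TwoSquare T L R B) : Prop :=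
  ∃ (_ : L.IsLeftAdjoint) (_ : R.IsLeftAdjoint),
    IsIso (mateEquiv (Adjunction.ofIsLeftAdjoint L) (Adjunction.ofIsLeftAdjoint R) σ).natTrans

/-- A square of functors has the right Beck-Chevalley property if its two horizontal functors have
left adjoints and the base change morphism `R ⋙ L₂ ⟶ L₁ ⋙ L` (the mate of the given 2-cell)
is an isomorphism. -/
def CategoryTheory.TwoSquare.IsRightBeckChevalley {C₁ C₂ C₃ C₄ : Type*} [Category* C₁]
    [Category* C₂] [Category* C₃] [Category* C₄] {T : C₁ ⥤ C₂} {L : C₁ ⥤ C₃} {R : C₂ ⥤ C₄}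
    {B : C₃ ⥤ C₄} (σ : TwoSquare T L R B) : Prop :=
  ∃ (_ : T.IsRightAdjoint) (_ : B.IsRightAdjoint),
    IsIso ((mateEquiv (Adjunction.ofIsRightAdjoint T)
      (Adjunction.ofIsRightAdjoint B)).symm σ).natTrans

/-- The punctual category `e`. -/
abbrev PtCat : Type s := Discrete PUnit.{s + 1}

/-- The comma square with top `A/b ⥤ A`, left `A/b ⥤ e`, right `F` and bottom `b : e ⥤ B`. -/
def commaSquareLeft {A B : Type s} [SmallCategory A] [SmallCategory B] (F : A ⥤ B) (b : B) :
    TwoSquare (CostructuredArrow.proj F b) (Functor.star.{s} (CostructuredArrow F b)) F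
      (Functor.fromPUnit.{s} b) :=
  TwoSquare.mk _ _ _ _
    { app := fun X => X.hom
      naturality := fun _ _ f =>
        (CostructuredArrow.w f).trans (Category.comp_id _).symm }

/-- The comma square with top `b\A ⥤ e`, left `b\A ⥤ A`, right `b : e ⥤ B` and bottom `F`. -/
def commaSquareRight {A B : Type s} [SmallCategory A] [SmallCategory B] (F : A ⥤ B) (b : B) :
    TwoSquare (Functor.star.{s} (StructuredArrow b F)) (StructuredArrow.proj b F)
      (Functor.fromPUnit.{s} b) F :=
  TwoSquare.mk _ _ _ _
    { app := fun X => X.hom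
      naturality := fun _ _ f =>
        (Category.id_comp _).trans (StructuredArrow.w f).symm }

/-- The commutative square with top `F : A ⥤ B`, bottom the identity of `e`, and sides `A ⥤ e`
and `B ⥤ e`. -/
def overPointSquare {A B : Type s} [SmallCategory A] [SmallCategory B] (F : A ⥤ B) :
    TwoSquare F (Functor.star.{s} A) (Functor.star.{s} B) (𝟭 PtCat.{s}) :=
  TwoSquare.mk _ _ _ _ (𝟙 (F ⋙ Functor.star.{s} B))

/-- A class of functors between small categories. -/
abbrev FunctorClass : Type (s + 1) :=
  ∀ ⦃A B : Type s⦄ [SmallCategory A] [SmallCategory B], (A ⥤ B) → Prop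

/-- `F : A ⥤ B` is `W`-coaspherical if for every object `b` of `B` the functor `b\A ⥤ b\B`
induced by `F` belongs to `W`. -/
def FunctorClass.IsCoaspherical (W : FunctorClass.{s}) {A B : Type s} [SmallCategory A]
    [SmallCategory B] (F : A ⥤ B) : Prop :=
  ∀ b : B, W (StructuredArrow.toUnder b F)

/-- A square `α : v ⋙ u ⟶ u' ⋙ w` of small categories is `W`-exact if for every object `b'` of
`B'` the functor `A'/b' ⥤ A/w(b')`, `(a', g') ↦ (v(a'), w(g') ∘ α_{a'})`, is `W`-coaspherical. -/
def FunctorClass.IsExact (W : FunctorClass.{s}) {A' A B' B : Type s} [SmallCategory A']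
    [SmallCategory A] [SmallCategory B'] [SmallCategory B] {v : A' ⥤ A} {u' : A' ⥤ B'}
    {u : A ⥤ B} {w : B' ⥤ B} (α : TwoSquare v u' u w) : Prop :=
  ∀ b' : B', W.IsCoaspherical (α.costructuredArrowRightwards b')

/-- A prederivator: a strict 2-functor from small categories to categories, contravariant both on
functors and on natural transformations. `pull F` is the inverse image functor of `F`. -/
structure Prederivator where
  obj (A : Type s) [SmallCategory A] : Type u₁
  category (A : Type s) [SmallCategory A] : Category.{v₁} (obj A)
  pull {A B : Type s} [SmallCategory A] [SmallCategory B] (F : A ⥤ B) : obj B ⥤ obj A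
  pull₂ {A B : Type s} [SmallCategory A] [SmallCategory B] {F G : A ⥤ B} (α : F ⟶ G) :
    pull G ⟶ pull F
  pull_id (A : Type s) [SmallCategory A] : pull (𝟭 A) = 𝟭 (obj A)
  pull_comp {A B C : Type s} [SmallCategory A] [SmallCategory B] [SmallCategory C]
    (F : A ⥤ B) (G : B ⥤ C) : pull (F ⋙ G) = pull G ⋙ pull F
  pull₂_id {A B : Type s} [SmallCategory A] [SmallCategory B] (F : A ⥤ B) :
    pull₂ (𝟙 F) = 𝟙 (pull F)
  pull₂_comp {A B : Type s} [SmallCategory A] [SmallCategory B] {F G H : A ⥤ B}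
    (α : F ⟶ G) (β : G ⟶ H) : pull₂ (α ≫ β) = pull₂ β ≫ pull₂ α
  pull₂_whiskerLeft {A B C : Type s} [SmallCategory A] [SmallCategory B] [SmallCategory C]
    (F : A ⥤ B) {G H : B ⥤ C} (α : G ⟶ H) :
    pull₂ (Functor.whiskerLeft F α) = eqToHom (pull_comp F H) ≫
      Functor.whiskerRight (pull₂ α) (pull F) ≫ eqToHom (pull_comp F G).symm
  pull₂_whiskerRight {A B C : Type s} [SmallCategory A] [SmallCategory B] [SmallCategory C]
    {F G : A ⥤ B} (α : F ⟶ G) (H : B ⥤ C) :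
    pull₂ (Functor.whiskerRight α H) = eqToHom (pull_comp G H) ≫
      Functor.whiskerLeft (pull H) (pull₂ α) ≫ eqToHom (pull_comp F H).symm

namespace Prederivator

attribute [instance] Prederivator.category

variable (D : Prederivator.{s, v₁, u₁})

/-- The image of a square of small categories under `D`: its top is `w^*`, its left is `u^*`, its
right is `u'^*` and its bottom is `v^*`. -/
def mapSquare {A' A B' B : Type s} [SmallCategory A'] [SmallCategory A] [SmallCategory B']
    [SmallCategory B] {v : A' ⥤ A} {u' : A' ⥤ B'} {u : A ⥤ B} {w : B' ⥤ B}
    (α : TwoSquare v u' u w) :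
    TwoSquare (D.pull w) (D.pull u) (D.pull u') (D.pull v) :=
  TwoSquare.mk _ _ _ _
    (eqToHom (D.pull_comp u' w).symm ≫ D.pull₂ α.natTrans ≫ eqToHom (D.pull_comp v u))

/-- The cohomological base change property: `u^*` and `u'^*` have right adjoints `u_*` and `u'_*`,
and the base change morphism `w^* u_* ⟶ u'_* v^*` is an isomorphism. -/
def HasCohomologicalBaseChange {A' A B' B : Type s} [SmallCategory A'] [SmallCategory A]
    [SmallCategory B'] [SmallCategory B] {v : A' ⥤ A} {u' : A' ⥤ B'} {u : A ⥤ B} {w : B' ⥤ B}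
    (α : TwoSquare v u' u w) : Prop :=
  (D.mapSquare α).IsLeftBeckChevalley

/-- The homological base change property: `v^*` and `w^*` have left adjoints `v_!` and `w_!`,
and the base change morphism `v_! u'^* ⟶ u^* w_!` is an isomorphism. -/
def HasHomologicalBaseChange {A' A B' B : Type s} [SmallCategory A'] [SmallCategory A]
    [SmallCategory B'] [SmallCategory B] {v : A' ⥤ A} {u' : A' ⥤ B'} {u : A ⥤ B} {w : B' ⥤ B}
    (α : TwoSquare v u' u w) : Prop :=
  (D.mapSquare α).IsRightBeckChevalley

/-- Normalization: `D` sends finite coproducts to products, up to equivalence. -/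
def IsNormalized : Prop :=
  ∀ (I : Type s) [Finite I] (A : I → Type s) [∀ i, SmallCategory (A i)],
    (Functor.pi' fun i => D.pull (Sigma.incl (C := A) i)).IsEquivalence

/-- Conservativity: isomorphisms of `D(A)` are detected on the objects of `A`. -/
def IsConservative : Prop :=
  ∀ (A : Type s) [SmallCategory A] (X Y : D.obj A) (φ : X ⟶ Y),
    (∀ a : A, IsIso ((D.pull (Functor.fromPUnit.{s} a)).map φ)) → IsIso φ

/-- Existence of cohomological direct images. -/
def HasCohomologicalDirectImages : Prop :=
  ∀ (A B : Type s) [SmallCategory A] [SmallCategory B] (F : A ⥤ B), (D.pull F).IsLeftAdjoint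

/-- Existence of homological direct images. -/
def HasHomologicalDirectImages : Prop :=
  ∀ (A B : Type s) [SmallCategory A] [SmallCategory B] (F : A ⥤ B), (D.pull F).IsRightAdjoint

/-- Completeness: cohomological direct images exist and their fibres are computed by the comma
squares of the categories `A/b`. -/
def IsComplete : Prop :=
  D.HasCohomologicalDirectImages ∧
    ∀ (A B : Type s) [SmallCategory A] [SmallCategory B] (F : A ⥤ B) (b : B),
      D.HasCohomologicalBaseChange (commaSquareLeft F b)

/-- Cocompleteness: homological direct images exist and their fibres are computed by the comma
squares of the categories `b\A`. -/
def IsCocomplete : Prop :=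
  D.HasHomologicalDirectImages ∧
    ∀ (A B : Type s) [SmallCategory A] [SmallCategory B] (F : A ⥤ B) (b : B),
      D.HasHomologicalBaseChange (commaSquareRight F b)

/-- A derivator. -/
def IsDerivator : Prop :=
  D.IsNormalized ∧ D.IsConservative ∧ D.IsComplete ∧ D.IsCocomplete

/-- The class of `D`-equivalences: functors `F : A ⥤ B` such that `F^*` is fully faithful on the
objects `q^*(X)` of `D(B)`, where `X` is an object of `D(e)` and `q : B ⥤ e`. -/
def equivalences : FunctorClass.{s} := fun _ B _ _ F =>
  ∀ X Y : D.obj PtCat.{s},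
    Function.Bijective fun f : (D.pull (Functor.star.{s} B)).obj X ⟶
      (D.pull (Functor.star.{s} B)).obj Y => (D.pull F).map f

/-- `D`-coaspherical functors. -/
def IsCoaspherical {A B : Type s} [SmallCategory A] [SmallCategory B] (F : A ⥤ B) : Prop :=
  D.equivalences.IsCoaspherical F

/-- `D`-exact squares. -/
def IsExact {A' A B' B : Type s} [SmallCategory A'] [SmallCategory A] [SmallCategory B']
    [SmallCategory B] {v : A' ⥤ A} {u' : A' ⥤ B'} {u : A ⥤ B} {w : B' ⥤ B}
    (α : TwoSquare v u' u w) : Prop :=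
  D.equivalences.IsExact α

/-- The cohomological criterion for coaspherical morphisms. -/
def SatisfiesCohomologicalCriterion : Prop :=
  D.HasCohomologicalDirectImages ∧
    ∀ (A B : Type s) [SmallCategory A] [SmallCategory B] (F : A ⥤ B),
      D.IsCoaspherical F → D.HasCohomologicalBaseChange (overPointSquare F)

end Prederivator

end

/-! Both claims rest on the compatibility of mates with pasting. For an exact square, conservativity
reduces the claim to the fibre at each `b'`. There the comma square of `u'` is pasted on; this has
the same 2-cell as the point square of `A'/b' ⥤ A/w(b')` pasted with the comma square of `u` at
`w(b')`. These two have base change, and `IsLeftBeckChevalley.isIso_map_mate` cancels the comma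
square of `u'`.

For a derivator, write `q : B ⥤ e`. If `F` is coaspherical, inverse image from `e` to each `b\A` is
fully faithful, because `b\B` has an initial object. Cocompleteness then makes the counit `F_! F^*
q^* X ⟶ q^* X` invertible fibrewise (`isIso_counit_app_of_isCoaspherical`). Hence `F^*` is bijective
on morphisms out of `q^* X`, and Yoneda gives the criterion. -/

namespace CategoryTheory.TwoSquare

/-! ### Pasting Beck-Chevalley squares. -/

section

variable {C₁ C₂ C₃ C₄ C₅ C₆ : Type*} [Category* C₁] [Category* C₂] [Category* C₃] [Category* C₄]
  [Category* C₅] [Category* C₆]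

/-- The left Beck-Chevalley property is invariant under replacing the horizontal functors by equal
functors. -/
theorem IsLeftBeckChevalley.of_eqToHom {T T' : C₁ ⥤ C₂} {L : C₁ ⥤ C₃} {R : C₂ ⥤ C₄}
    {B B' : C₃ ⥤ C₄} {σ : TwoSquare T L R B} {σ' : TwoSquare T' L R B'} (hT : T' = T)
    (hB : B = B')
    (h : ∀ X, σ'.natTrans.app X =
      eqToHom (by rw [hT]) ≫ σ.natTrans.app X ≫ eqToHom (by rw [hB]))
    (hσ : σ.IsLeftBeckChevalley) : σ'.IsLeftBeckChevalley := by
  subst hT hB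
  obtain rfl : σ' = σ := by
    ext X
    simp [h]
  exact hσ

theorem isLeftBeckChevalley_iff {T : C₁ ⥤ C₂} {L : C₁ ⥤ C₃} {R : C₂ ⥤ C₄} {B : C₃ ⥤ C₄}
    (σ : TwoSquare T L R B) [L.IsLeftAdjoint] [R.IsLeftAdjoint] :
    σ.IsLeftBeckChevalley ↔ ∀ X, IsIso ((mateEquiv (Adjunction.ofIsLeftAdjoint L)
      (Adjunction.ofIsLeftAdjoint R) σ).natTrans.app X) := by
  rw [← NatTrans.isIso_iff_isIso_app]
  exact ⟨fun ⟨_, _, h⟩ => h, fun h => ⟨inferInstance, inferInstance, h⟩⟩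

theorem mateEquiv_hComp_app {T : C₁ ⥤ C₂} {L : C₁ ⥤ C₃} {R : C₂ ⥤ C₄} {B : C₃ ⥤ C₄}
    {T' : C₂ ⥤ C₅} {R' : C₅ ⥤ C₆} {B' : C₄ ⥤ C₆} (σ : TwoSquare T L R B)
    (τ : TwoSquare T' R R' B') [L.IsLeftAdjoint] [R.IsLeftAdjoint] [R'.IsLeftAdjoint] (X : C₃) :
    (mateEquiv (Adjunction.ofIsLeftAdjoint L) (Adjunction.ofIsLeftAdjoint R')
      (σ.hComp τ)).natTrans.app X =
      T'.map ((mateEquiv (Adjunction.ofIsLeftAdjoint L) (Adjunction.ofIsLeftAdjoint R)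
        σ).natTrans.app X) ≫
      (mateEquiv (Adjunction.ofIsLeftAdjoint R) (Adjunction.ofIsLeftAdjoint R')
        τ).natTrans.app (B.obj X) := by
  rw [mateEquiv_vcomp _ (Adjunction.ofIsLeftAdjoint R)]
  simp [vComp, natTrans]

theorem IsLeftBeckChevalley.hComp {T : C₁ ⥤ C₂} {L : C₁ ⥤ C₃} {R : C₂ ⥤ C₄} {B : C₃ ⥤ C₄}
    {T' : C₂ ⥤ C₅} {R' : C₅ ⥤ C₆} {B' : C₄ ⥤ C₆} {σ : TwoSquare T L R B}
    {τ : TwoSquare T' R R' B'} (hσ : σ.IsLeftBeckChevalley) (hτ : τ.IsLeftBeckChevalley) :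
    (σ.hComp τ).IsLeftBeckChevalley := by
  have := hσ.1
  have := hτ.1
  have := hτ.2.1
  rw [isLeftBeckChevalley_iff] at hσ hτ ⊢
  intro X
  have := hσ X
  have := hτ (B.obj X)
  rw [mateEquiv_hComp_app]
  infer_instance

/-- Two out of three in `mateEquiv_hComp_app`. -/
theorem IsLeftBeckChevalley.isIso_map_mate {T : C₁ ⥤ C₂} {L : C₁ ⥤ C₃} {R : C₂ ⥤ C₄}
    {B : C₃ ⥤ C₄} {T' : C₂ ⥤ C₅} {R' : C₅ ⥤ C₆} {B' : C₄ ⥤ C₆} {σ : TwoSquare T L R B}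
    {τ : TwoSquare T' R R' B'} [L.IsLeftAdjoint] [R.IsLeftAdjoint]
    (hστ : (σ.hComp τ).IsLeftBeckChevalley) (hτ : τ.IsLeftBeckChevalley) (X : C₃) :
    IsIso (T'.map ((mateEquiv (Adjunction.ofIsLeftAdjoint L) (Adjunction.ofIsLeftAdjoint R)
        σ).natTrans.app X)) := by
  have := hτ.2.1
  rw [isLeftBeckChevalley_iff] at hστ hτ
  have := hτ (B.obj X)
  have := hστ X
  rw [mateEquiv_hComp_app] at this
  exact IsIso.of_isIso_comp_right _ ((mateEquiv (Adjunction.ofIsLeftAdjoint R)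
    (Adjunction.ofIsLeftAdjoint R') τ).natTrans.app (B.obj X))

end

end CategoryTheory.TwoSquare

/-! ### Base change for exact squares. -/

namespace Prederivator

variable (D : Prederivator.{s, v₁, u₁})

section

variable {A'' A' A B'' B' B : Type s} [SmallCategory A''] [SmallCategory A'] [SmallCategory A]
  [SmallCategory B''] [SmallCategory B'] [SmallCategory B]

/-- Contravariance on functors reverses the order of pasting. -/
theorem mapSquare_hComp_app {v' : A'' ⥤ A'} {u'' : A'' ⥤ B''} {u' : A' ⥤ B'} {w' : B'' ⥤ B'}
    {v : A' ⥤ A} {u : A ⥤ B} {w : B' ⥤ B} (β : TwoSquare v' u'' u' w')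
    (α : TwoSquare v u' u w) (X : D.obj B) :
    (D.mapSquare (β.hComp α)).natTrans.app X =
      eqToHom (by rw [D.pull_comp]) ≫
        ((D.mapSquare α).hComp (D.mapSquare β)).natTrans.app X ≫
          eqToHom (by rw [D.pull_comp]) := by
  have h : (β.hComp α).natTrans = Functor.whiskerLeft v' α.natTrans ≫
      Functor.whiskerRight β.natTrans w := by
    ext a
    simp [TwoSquare.hComp, TwoSquare.natTrans]
  have h' : D.pull₂ (β.hComp α).natTrans =
      D.pull₂ (Functor.whiskerRight β.natTrans w) ≫
      D.pull₂ (Functor.whiskerLeft v' α.natTrans) := by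
    rw [← D.pull₂_comp, h]
  rw [D.pull₂_whiskerLeft, D.pull₂_whiskerRight] at h'
  have h'' := congr_app h' X
  simp only [NatTrans.comp_app, eqToHom_app] at h''
  simp only [mapSquare, TwoSquare.hComp, TwoSquare.natTrans, NatTrans.comp_app,
    eqToHom_app] at h'' ⊢
  rw [h'']
  simp [eqToHom_map, eqToHom_app]

/-- Cohomological base change only depends on the horizontal functors up to equality. -/
theorem HasCohomologicalBaseChange.of_app_eq {D : Prederivator.{s, v₁, u₁}} {v v' : A' ⥤ A}
    {u' : A' ⥤ B'} {u : A ⥤ B} {w w' : B' ⥤ B} {α : TwoSquare v u' u w}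
    {α' : TwoSquare v' u' u w'} (hv : v' = v) (hw : w = w')
    (h : ∀ X, α'.natTrans.app X =
      eqToHom (by rw [hv]) ≫ α.natTrans.app X ≫ eqToHom (by rw [hw]))
    (hα : D.HasCohomologicalBaseChange α) : D.HasCohomologicalBaseChange α' := by
  subst hv hw
  obtain rfl : α' = α := by
    ext X
    simp [h]
  exact hα

/-- In a conservative complete prederivator satisfying the cohomological criterion for coaspherical
morphisms, exact squares have the cohomological base change property. -/
theorem hasCohomologicalBaseChange_of_isExact (hc : D.IsConservative) (hd : D.IsComplete)
    (hcrit : D.SatisfiesCohomologicalCriterion) {v : A' ⥤ A} {u' : A' ⥤ B'} {u : A ⥤ B}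
    {w : B' ⥤ B} (α : TwoSquare v u' u w) (hα : D.IsExact α) :
    D.HasCohomologicalBaseChange α := by
  have := hd.1 _ _ u
  have := hd.1 _ _ u'
  refine (TwoSquare.isLeftBeckChevalley_iff _).2 fun X => hc _ _ _ _ fun b' => ?_
  refine TwoSquare.IsLeftBeckChevalley.isIso_map_mate (τ := D.mapSquare (commaSquareLeft u' b'))
    ?_ (hd.2 _ _ u' b') X
  have h₁ := hd.2 _ _ u (w.obj b')
  have h₂ := hcrit.2 _ _ _ (hα b')
  have h₃ := TwoSquare.IsLeftBeckChevalley.hComp h₁ h₂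
  have h₄ : D.HasCohomologicalBaseChange ((overPointSquare (α.costructuredArrowRightwards b')).hComp
      (commaSquareLeft u (w.obj b'))) :=
    h₃.of_eqToHom (D.pull_comp _ _) (D.pull_comp _ _).symm (D.mapSquare_hComp_app _ _)
  -- At `(a', g')` both pasted 2-cells are `w(g') ∘ α_{a'}`.
  have h₅ : D.HasCohomologicalBaseChange ((commaSquareLeft u' b').hComp α) := by
    have hv : CostructuredArrow.proj u' b' ⋙ v =
        α.costructuredArrowRightwards b' ⋙ CostructuredArrow.proj u (w.obj b') :=
      Functor.hext (fun _ => rfl) (fun _ _ _ => HEq.rfl)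
    have hw : 𝟭 PtCat.{s} ⋙ Functor.fromPUnit.{s} (w.obj b') = Functor.fromPUnit.{s} b' ⋙ w :=
      CategoryTheory.Functor.ext (fun _ => rfl) (by simp)
    refine h₄.of_app_eq hv hw fun Y => ?_
    have e₁ : ((commaSquareLeft u' b').hComp α).natTrans.app Y =
        α.natTrans.app Y.left ≫ w.map Y.hom := by
      simp [TwoSquare.natTrans, TwoSquare.hComp, commaSquareLeft]
      rfl
    have e₂ : ((overPointSquare (α.costructuredArrowRightwards b')).hComp
        (commaSquareLeft u (w.obj b'))).natTrans.app Y =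
        α.natTrans.app Y.left ≫ w.map Y.hom := by
      simp [TwoSquare.natTrans, TwoSquare.hComp, commaSquareLeft, overPointSquare]
      refine (Category.comp_id _).trans ?_
      simp [TwoSquare.costructuredArrowRightwards]
      rfl
    rw [e₁, e₂]
    exact ((Category.id_comp _).trans (Category.comp_id _)).symm
  refine h₅.of_eqToHom (D.pull_comp _ _).symm (D.pull_comp _ _) fun X => ?_
  rw [D.mapSquare_hComp_app]
  simp

end

end Prederivator

/-! ### From invertible counits to base change. -/

namespace CategoryTheory

section

variable {C₁ C₂ C₃ C₄ : Type*} [Category* C₁] [Category* C₂] [Category* C₃] [Category* C₄]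

/-- `R.map` is precomposition with the counit followed by the adjunction bijection. -/
theorem Adjunction.map_bijective_of_isIso_counit_app {L : C₁ ⥤ C₂} {R : C₂ ⥤ C₁} (adj : L ⊣ R)
    (X : C₂) [IsIso (adj.counit.app X)] (Y : C₂) :
    Function.Bijective fun f : X ⟶ Y => R.map f := by
  have h : (fun f : X ⟶ Y => R.map f) =
      fun f => adj.homEquiv _ _ (adj.counit.app X ≫ f) := by
    funext f
    simp [Adjunction.homEquiv_unit]
  rw [h]
  exact (adj.homEquiv _ _).bijective.comp
    ((isIso_iff_coyoneda_map_bijective (adj.counit.app X)).1 inferInstance Y)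

theorem TwoSquare.isLeftBeckChevalley_of_isIso_counit {L : C₁ ⥤ C₃} {R : C₁ ⥤ C₄} {B : C₃ ⥤ C₄}
    (σ : TwoSquare (𝟭 C₁) L R B) [L.IsLeftAdjoint] [R.IsLeftAdjoint] [B.IsRightAdjoint]
    [IsIso σ.natTrans]
    (h : ∀ X, IsIso ((Adjunction.ofIsRightAdjoint B).counit.app (L.obj X))) :
    σ.IsLeftBeckChevalley := by
  rw [isLeftBeckChevalley_iff]
  intro Y
  refine isIso_of_yoneda_map_bijective _ fun X => ?_
  have := h X
  have hB := (Adjunction.ofIsRightAdjoint B).map_bijective_of_isIso_counit_app (L.obj X) Y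
  -- Conjugated by the two adjunctions, composition with the mate becomes `f ↦ σ_X ≫ B.map f`.
  rw [← ((Adjunction.ofIsLeftAdjoint R).homEquiv _ _).symm.bijective.of_comp_iff',
    ← (((Adjunction.ofIsLeftAdjoint L).homEquiv X Y).bijective.of_comp_iff)]
  have key := ((isIso_iff_coyoneda_map_bijective (σ.natTrans.app X)).1 inferInstance
    (B.obj Y)).comp hB
  refine (congrArg Function.Bijective (funext fun f => ?_)).mpr key
  have h₁ := mateEquiv_counit (Adjunction.ofIsLeftAdjoint L) (Adjunction.ofIsLeftAdjoint R) σ Y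
  have h₂ := σ.natTrans.naturality ((Adjunction.ofIsLeftAdjoint L).homEquiv X Y f)
  simp only [Function.comp_apply, Adjunction.homEquiv_counit, Functor.map_comp, Category.assoc]
  refine (congrArg (_ ≫ ·) h₁).trans ?_
  refine (Category.assoc _ _ _).symm.trans ?_
  refine (congrArg (· ≫ _) h₂).trans ?_
  rw [Category.assoc, Functor.comp_map, ← Functor.map_comp]
  exact congrArg (fun g => σ.natTrans.app X ≫ B.map g)
    (((Adjunction.ofIsLeftAdjoint L).homEquiv_counit _ _ _).symm.trans (Equiv.symm_apply_apply _ _))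

end

end CategoryTheory

/-! ### The cohomological criterion in a derivator. -/

namespace Prederivator

variable (D : Prederivator.{s, v₁, u₁})

section

variable {A B C : Type s} [SmallCategory A] [SmallCategory B] [SmallCategory C]

theorem pull_comp_map (F : A ⥤ B) (G : B ⥤ C) {X Y : D.obj C} (f : X ⟶ Y) :
    (D.pull (F ⋙ G)).map f = eqToHom (by rw [D.pull_comp]; rfl) ≫
      (D.pull F).map ((D.pull G).map f) ≫ eqToHom (by rw [D.pull_comp]; rfl) :=
  Functor.congr_hom (D.pull_comp F G) f

theorem pull₂_eqToHom {F G : A ⥤ B} (h : F = G) :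
    D.pull₂ (eqToHom h) = eqToHom (by rw [h]) := by
  subst h
  exact D.pull₂_id _

theorem pull₂_toPoint {F G : A ⥤ PtCat.{s}} (α : F ⟶ G) :
    D.pull₂ α = eqToHom (by rw [Functor.punit_ext' F G]) := by
  rw [← D.pull₂_eqToHom (Functor.punit_ext' F G)]
  congr 1
  ext
  exact Subsingleton.elim _ _

/-- The components of `D.pull₂ α` at the objects coming from a point are identities. -/
theorem pull₂_app_star {F G : A ⥤ B} (α : F ⟶ G) (X : D.obj PtCat.{s}) :
    (D.pull₂ α).app ((D.pull (Functor.star.{s} B)).obj X) =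
      eqToHom (by
        rw [← Functor.comp_obj, ← Functor.comp_obj, ← D.pull_comp, ← D.pull_comp]
        rfl) := by
  -- Whiskered with `B ⥤ e`, `α` becomes a 2-cell between functors to `e`, hence an identity.
  have h := congr_app ((D.pull₂_whiskerRight α (Functor.star.{s} B)).symm.trans
    (D.pull₂_toPoint _)) X
  simp only [NatTrans.comp_app, eqToHom_app, Functor.whiskerLeft_app] at h
  rw [eqToHom_comp_iff, comp_eqToHom_iff] at h
  simpa using h

/-- The point `i` at `b` satisfies `i^* q^* = 𝟭`, whence injectivity. The 2-cell from the constant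
functor at `b` to `𝟭 B` gives surjectivity. -/
theorem pull_star_map_bijective_of_isInitial {b : B} (hb : Limits.IsInitial b)
    (X Y : D.obj PtCat.{s}) :
    Function.Bijective fun f : X ⟶ Y => (D.pull (Functor.star.{s} B)).map f := by
  let i : PtCat.{s} ⥤ B := Functor.fromPUnit.{s} b
  have hi : D.pull (Functor.star.{s} B) ⋙ D.pull i = 𝟭 _ := by
    rw [← D.pull_comp, ← D.pull_id]
    rfl
  let ε : Functor.star.{s} B ⋙ i ⟶ 𝟭 B :=
    { app := fun c => hb.to c
      naturality := fun _ _ _ => hb.hom_ext _ _ }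
  constructor
  · intro f g h
    have h' := congrArg (D.pull i).map h
    have hf := Functor.congr_hom hi f
    have hg := Functor.congr_hom hi g
    simp only [Functor.comp_map, Functor.id_map] at hf hg
    rw [← cancel_mono (eqToHom (Functor.congr_obj hi Y).symm),
      ← cancel_epi (eqToHom (Functor.congr_obj hi X))]
    exact hf.symm.trans (h'.trans hg)
  · intro f
    -- `pull₂ ε` is an identity on both `q^* X` and `q^* Y`, so naturality reads `q^* (i^* f) = f`
    -- up to `eqToHom`.
    have h := (D.pull₂ ε).naturality f
    rw [D.pull₂_app_star, D.pull₂_app_star] at h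
    refine ⟨eqToHom (Functor.congr_obj hi X).symm ≫ (D.pull i).map f ≫
      eqToHom (Functor.congr_obj hi Y), ?_⟩
    rw [D.pull_comp_map] at h
    have h' := Functor.congr_hom (D.pull_id B) f
    rw [h'] at h
    simp [eqToHom_map] at h ⊢
    have h₁ := (eqToHom_comp_iff _ _ _).1 h
    have h₂ := (comp_eqToHom_iff _ _ _).1 h₁
    simpa using h₂.symm

theorem pull_star_map_bijective_of_equivalences {F : A ⥤ B} (hF : D.equivalences F) {b : B}
    (hb : Limits.IsInitial b) (X Y : D.obj PtCat.{s}) :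
    Function.Bijective fun f : X ⟶ Y => (D.pull (Functor.star.{s} A)).map f := by
  have h := (hF X Y).comp (D.pull_star_map_bijective_of_isInitial hb X Y)
  have e (Z : D.obj PtCat.{s}) : (D.pull (Functor.star.{s} A)).obj Z =
    (D.pull F).obj ((D.pull (Functor.star.{s} B)).obj Z) :=
    Functor.congr_obj (D.pull_comp F (Functor.star.{s} B)) Z
  have := ((eqToIso (e X)).symm.homCongr (eqToIso (e Y)).symm).bijective.comp h
  convert this using 1
  funext f
  exact (D.pull_comp_map F (Functor.star.{s} B) f).trans (by simp; rfl)

end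

section

variable {A B : Type s} [SmallCategory A] [SmallCategory B]

theorem isIso_counit_app_of_isCoaspherical (hc : D.IsConservative) (hd : D.IsCocomplete)
    {F : A ⥤ B} (hF : D.IsCoaspherical F) [(D.pull F).IsRightAdjoint] (X : D.obj PtCat.{s}) :
    IsIso ((Adjunction.ofIsRightAdjoint (D.pull F)).counit.app
      ((D.pull (Functor.star.{s} B)).obj X)) := by
  refine hc _ _ _ _ fun b => ?_
  obtain ⟨_, hR, hm⟩ := hd.2 _ _ F b
  have hff := D.pull_star_map_bijective_of_equivalences (hF b) Under.mkIdInitial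
  let q := D.pull (Functor.star.{s} (StructuredArrow b F))
  have : q.IsRightAdjoint := hR
  have : q.Full := ⟨fun f => (hff _ _).2 f⟩
  have : q.Faithful := ⟨fun h => (hff _ _).1 h⟩
  have hσ : IsIso ((D.mapSquare (commaSquareRight F b)).natTrans.app
      ((D.pull (Functor.star.{s} B)).obj X)) := by
    have h := D.pull₂_app_star (commaSquareRight F b).natTrans X
    simp only [mapSquare, TwoSquare.natTrans, NatTrans.comp_app, eqToHom_app] at h ⊢
    rw [h]
    infer_instance
  -- The mate followed by the fibre at `b` of the counit of `F^*` equals an isomorphism followed by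
  -- the counit of the fully faithful `q`.
  have h := mateEquiv_counit_symm (Adjunction.ofIsRightAdjoint (D.pull F))
    (Adjunction.ofIsRightAdjoint q) (D.mapSquare (commaSquareRight F b))
    ((D.pull (Functor.star.{s} B)).obj X)
  have h₁ : IsIso ((Adjunction.ofIsRightAdjoint q).counit) := inferInstance
  have h₂ := NatIso.isIso_app_of_isIso ((mateEquiv (Adjunction.ofIsRightAdjoint (D.pull F))
    (Adjunction.ofIsRightAdjoint q)).symm (D.mapSquare (commaSquareRight F b))).natTrans
  refine @IsIso.of_isIso_comp_left _ _ _ _ _ _ _ (h₂ _) ?_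
  refine (congrArg IsIso h).mp ?_
  have := Functor.map_isIso q.leftAdjoint ((D.mapSquare (commaSquareRight F b)).natTrans.app
      ((D.pull (Functor.star.{s} B)).obj X))
  exact IsIso.comp_isIso' this inferInstance

theorem hasCohomologicalBaseChange_overPointSquare (hc : D.IsConservative)
    (hl : D.HasCohomologicalDirectImages) (hd : D.IsCocomplete) {F : A ⥤ B}
    (hF : D.IsCoaspherical F) : D.HasCohomologicalBaseChange (overPointSquare F) := by
  have := hl _ _ (Functor.star.{s} A)
  have := hl _ _ (Functor.star.{s} B)
  have := hd.1 _ _ F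
  -- The top of `mapSquare (overPointSquare F)` is `D.pull (𝟭 _)`; `σ` replaces it by a literal
  -- identity.
  let σ : TwoSquare (𝟭 _) (D.pull (Functor.star.{s} B)) (D.pull (Functor.star.{s} A))
      (D.pull F) := TwoSquare.mk _ _ _ _ (eqToHom (D.pull_comp F (Functor.star.{s} B)))
  have : IsIso σ.natTrans := inferInstanceAs (IsIso (eqToHom (D.pull_comp F (Functor.star.{s} B))))
  have hσ := σ.isLeftBeckChevalley_of_isIso_counit
    (D.isIso_counit_app_of_isCoaspherical hc hd hF)
  refine hσ.of_eqToHom (D.pull_id _) rfl fun X => ?_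
  have h : D.pull₂ (overPointSquare F).natTrans = eqToHom rfl := D.pull₂_id _
  simp only [mapSquare, TwoSquare.natTrans, NatTrans.comp_app, eqToHom_app, σ] at h ⊢
  rw [h]
  refine Eq.trans ?_ (congrArg (_ ≫ · ≫ _)
    (eqToHom_app (D.pull_comp F (Functor.star.{s} B)) X).symm)
  simp only [eqToHom_trans]
  refine (congrArg (_ ≫ ·) (Category.id_comp _)).trans ?_
  exact (eqToHom_trans _ _).trans (eqToHom_trans _ _).symm

end

end Prederivator

theorem mainTheorem10 (D : Prederivator.{s, v₁, u₁}) :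
    (D.IsConservative → D.IsComplete → D.SatisfiesCohomologicalCriterion →
      ∀ {A' A B' B : Type s} [SmallCategory A'] [SmallCategory A] [SmallCategory B']
        [SmallCategory B] {v : A' ⥤ A} {u' : A' ⥤ B'} {u : A ⥤ B} {w : B' ⥤ B}
        (α : TwoSquare v u' u w),
        D.IsExact α → D.HasCohomologicalBaseChange α) ∧
    (D.IsDerivator →
      D.IsConservative ∧ D.IsComplete ∧ D.SatisfiesCohomologicalCriterion) := by
  refine ⟨fun hc hd h => D.hasCohomologicalBaseChange_of_isExact hc hd h,
    fun h => ⟨h.2.1, h.2.2.1, h.2.2.1.1,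
    fun A B _ _ F hF => D.hasCohomologicalBaseChange_overPointSquare h.2.1 h.2.2.1.1 h.2.2.2 hF⟩⟩
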